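/- Let \(E\) be a finite-dimensional real inner product space. For \(a\in E\) (possibly \(a=0\)) and \(\beta\in\mathbb{R}\) put \(H(a,\beta)=\{x\in E:\langle a,x\rangle=\beta\}\) and \(H^{\le}(a,\beta)=\{x\in E:\langle a,x\rangle\le\beta\}\), and call the latter sets halfspaces. A polyhedron is an intersection of finitely many halfspaces, and a polytope is a bounded polyhedron. A locally finite polyhedron is an intersection of countably many halfspaces whose intersection with every polytope is a polytope. A face of a set \(\mathcal{P}\subseteq E\) is a set of the form \(\mathcal{P}\cap H(a,\beta)\) with \(\mathcal{P}\subseteq H^{\le}(a,\beta)\); in particular, \(\mathcal{P}\) is a face of itself. A vertex of \(\mathcal{P}\) is a point \(V\) such that \(\{V\}\) is a face of \(\mathcal{P}\), and an edge is a face whose affine hull has dimension \(1\). An extreme ray of \(\mathcal{P}\) is an unbounded edge that contains a vertex of \(\mathcal{P}\). A vector \(R\in E\) is a direction vector of an extreme ray of \(\mathcal{P}\) if \(\{V+tR : t\ge 0\}\) is an extreme ray of \(\mathcal{P}\) for some \(V\in E\). For \(S\subseteq E\), \(\operatorname{cone} S\) is the set of all finite linear combinations of elements of \(S\) with nonnegative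 coefficients (so \(\operatorname{cone}\emptyset=\{0\}\)). Proposition. Let \(\mathcal{P}\subseteq E\) be a locally finite polyhedron that has a vertex. Then \[ \mathcal{P}=\operatorname{conv}\{V : V \text{ is a vertex of } \mathcal{P}\}+\operatorname{cone}\{R : R \text{ is a direction vector of an extreme ray of } \mathcal{P}\}. \] -/

import Mathlib

open scoped Pointwise

namespace Polyhedral

variable {E : Type*} [NormedAddCommGroup E] [InnerProductSpace ℝ E]

/-- The hyperplane `H(a, β) = {x | ⟪a, x⟫ = β}`. The vector `a = 0` is allowed, so that every set
is a face of itself. -/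
def hyperplane (a : E) (β : ℝ) : Set E := {x | inner ℝ a x = β}

/-- The halfspace `H≤(a, β) = {x | ⟪a, x⟫ ≤ β}`. -/
def halfspace (a : E) (β : ℝ) : Set E := {x | inner ℝ a x ≤ β}

/-- A polyhedron is an intersection of finitely many halfspaces. -/
def IsPolyhedron (P : Set E) : Prop :=
  ∃ s : Finset (E × ℝ), P = ⋂ h ∈ s, halfspace h.1 h.2

/-- A polytope is a bounded polyhedron. -/
def IsPolytope (P : Set E) : Prop :=
  IsPolyhedron P ∧ Bornology.IsBounded P

/-- A locally finite polyhedron is an intersection of countably many halfspaces whose intersection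
with every polytope is a polytope. -/
def IsLocallyFinitePolyhedron (P : Set E) : Prop :=
  (∃ (a : ℕ → E) (β : ℕ → ℝ), P = ⋂ i, halfspace (a i) (β i)) ∧
    ∀ Q : Set E, IsPolytope Q → IsPolytope (P ∩ Q)

/-- `F` is a face of `P`: the part of `P` on a hyperplane that has all of `P` on one side. The other
side of `H(a, β)` is `halfspace (-a) (-β)`, so one choice of side is enough. -/
def IsFace (P F : Set E) : Prop :=
  ∃ (a : E) (β : ℝ), P ⊆ halfspace a β ∧ F = P ∩ hyperplane a β

/-- A vertex is (the point of) a zero-dimensional face. -/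
def IsVertex (P : Set E) (v : E) : Prop := IsFace P {v}

/-- An edge is a one-dimensional face. -/
def IsEdge (P F : Set E) : Prop :=
  IsFace P F ∧ Module.finrank ℝ (vectorSpan ℝ F) = 1

/-- An extreme ray is an unbounded edge with a vertex. -/
def IsExtremeRay (P F : Set E) : Prop :=
  IsEdge P F ∧ ¬ Bornology.IsBounded F ∧ ∃ v ∈ F, IsVertex P v

/-- `R` is a direction vector of the extreme ray `{V + t R | t ≥ 0}` of `P`, for some point `V`
(which is then the vertex on that ray). -/
def IsExtremeRayDirection (P : Set E) (R : E) : Prop :=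
  ∃ V : E, IsExtremeRay P {x | ∃ t : ℝ, 0 ≤ t ∧ x = V + t • R}

end Polyhedral

namespace Polyhedral

variable {E : Type*} [NormedAddCommGroup E] [InnerProductSpace ℝ E]

/-! The inclusion from right to left holds because `P` is convex and stable under translation along
any ray it contains (`add_mem_of_mem_hull`). For the other one, let `D` be the space of directions
feasible both ways at `x ∈ P`; induct on `dim D` (`subset_of_convex`). If `D = 0`, then `x` is a
vertex. If some line through `x` along `D` leaves `P` at both ends, `x` lies between the two exit
points, whose spaces are strictly smaller. Otherwise each nonzero direction of `D`, up to sign,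
spans a ray in `P`. A functional exposing a vertex is negative on ray directions, hence injective on
`D`, so `dim D = 1`; going backwards from `x` ends at a vertex, and `x` lies on an extreme ray.
Local finiteness enters through `exists_active`: it makes the smallest face around `x` an exposed
face. -/

theorem convex_halfspace (a : E) (β : ℝ) : Convex ℝ (halfspace a β) :=
  convex_halfSpace_le (innerₗ E a).isLinear β

theorem IsLocallyFinitePolyhedron.convex {P : Set E} (hP : IsLocallyFinitePolyhedron P) :
    Convex ℝ P := by
  obtain ⟨⟨a, β, rfl⟩, -⟩ := hP
  exact convex_iInter fun i => convex_halfspace _ _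

theorem IsLocallyFinitePolyhedron.isClosed {P : Set E} (hP : IsLocallyFinitePolyhedron P) :
    IsClosed P := by
  obtain ⟨⟨a, β, rfl⟩, -⟩ := hP
  exact isClosed_iInter fun i => isClosed_le (by fun_prop) continuous_const

/-- If a locally finite polyhedron contains a ray, then it is closed under translation along it. -/
theorem IsLocallyFinitePolyhedron.add_mem_of_ray {P : Set E} (hP : IsLocallyFinitePolyhedron P)
    {x d : E} (hray : ∀ t : ℝ, 0 ≤ t → x + t • d ∈ P) {y : E} (hy : y ∈ P) : y + d ∈ P := by
  obtain ⟨⟨a, β, rfl⟩, -⟩ := hP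
  simp only [Set.mem_iInter, halfspace, Set.mem_ofPred_eq, inner_add_right, inner_smul_right]
    at hray hy ⊢
  intro i
  have hd : inner ℝ (a i) d ≤ 0 := by
    by_contra! hpos
    have hx := hray 0 le_rfl i
    -- At this parameter the functional takes the value `β i + 1`.
    have h := hray ((β i - inner ℝ (a i) x + 1) / inner ℝ (a i) d)
      (div_nonneg (by linarith) hpos.le) i
    rw [div_mul_cancel₀ _ hpos.ne'] at h
    linarith
  linarith [hy i]

/-- Every point of a finite-dimensional space has a neighbourhood that is a polytope. -/
theorem exists_isPolytope_mem_nhds [FiniteDimensional ℝ E] (x : E) :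
    ∃ Q : Set E, IsPolytope Q ∧ Q ∈ nhds x := by
  classical
  set b := stdOrthonormalBasis ℝ E with hb
  let s : Finset (E × ℝ) :=
    (Finset.univ.image fun i => (b i, inner ℝ (b i) x + 1)) ∪
      Finset.univ.image fun i => (-b i, -inner ℝ (b i) x + 1)
  have hmem : ∀ z, z ∈ (⋂ h ∈ s, halfspace h.1 h.2) ↔ ∀ i, |inner ℝ (b i) (z - x)| ≤ 1 := by
    intro z
    simp only [s, Set.mem_iInter, Finset.mem_union, Finset.mem_image, Finset.mem_univ, true_and,
      halfspace, Set.mem_ofPred_eq, inner_sub_right, abs_le]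
    constructor
    · intro h i
      have h1 := h _ (Or.inl ⟨i, rfl⟩)
      have h2 := h _ (Or.inr ⟨i, rfl⟩)
      simp only [inner_neg_left] at h1 h2
      constructor <;> linarith
    · rintro h _ (⟨i, rfl⟩ | ⟨i, rfl⟩)
      · have := h i
        simp only
        linarith
      · have := h i
        simp only [inner_neg_left]
        linarith
  refine ⟨⋂ h ∈ s, halfspace h.1 h.2, ⟨⟨s, rfl⟩, ?_⟩, ?_⟩
  · refine (Metric.isBounded_closedBall (x := x)
      (r := ∑ _i : Fin (Module.finrank ℝ E), (1 : ℝ))).subset fun z hz => ?_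
    rw [hmem] at hz
    rw [mem_closedBall_iff_norm, ← b.sum_repr' (z - x)]
    refine norm_sum_le_of_le _ fun i _ => ?_
    rw [norm_smul, b.norm_eq_one, mul_one]
    exact hz i
  · filter_upwards [Metric.closedBall_mem_nhds x one_pos] with z hz
    rw [hmem]
    intro i
    rw [mem_closedBall_iff_norm] at hz
    calc |inner ℝ (b i) (z - x)| ≤ ‖b i‖ * ‖z - x‖ := abs_real_inner_le_norm _ _
      _ ≤ 1 := by rw [b.norm_eq_one, one_mul]; exact hz

/-! ### Feasible directions and minimal faces -/

/-- One can move from `x` a positive distance in the direction `u` without leaving the convex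
set `P`. -/
def IsFeasibleDirection (P : Set E) (x u : E) : Prop := ∃ t : ℝ, 0 < t ∧ x + t • u ∈ P

/-- Near each of its points, a locally finite polyhedron is cut out by finitely many constraints
that are active at the point. -/
theorem IsLocallyFinitePolyhedron.exists_active [FiniteDimensional ℝ E] {P : Set E}
    (hP : IsLocallyFinitePolyhedron P) {x : E} (hx : x ∈ P) :
    ∃ A : Finset E, ∀ u, IsFeasibleDirection P x u ↔ ∀ a ∈ A, inner ℝ a u ≤ 0 := by
  classical
  obtain ⟨Q, hQ, hQx⟩ := exists_isPolytope_mem_nhds x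
  obtain ⟨⟨s, hs⟩, -⟩ := hP.2 Q hQ
  have hmem : ∀ z, (z ∈ P ∧ z ∈ Q) ↔ ∀ h ∈ s, inner ℝ h.1 z ≤ h.2 := by
    intro z
    have : z ∈ P ∩ Q ↔ z ∈ ⋂ h ∈ s, halfspace h.1 h.2 := by rw [hs]
    simpa [halfspace] using this
  have hxs := (hmem x).1 ⟨hx, mem_of_mem_nhds hQx⟩
  refine ⟨(s.filter fun h => inner ℝ h.1 x = h.2).image Prod.fst, fun u => ?_⟩
  have hcont : Filter.Tendsto (fun t : ℝ => x + t • u) (nhdsWithin 0 (Set.Ioi 0)) (nhds x) := by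
    have : Continuous fun t : ℝ => x + t • u := by fun_prop
    simpa using this.continuousWithinAt (s := Set.Ioi 0) (x := 0) |>.tendsto
  constructor
  · rintro ⟨t, ht, htP⟩ a ha
    obtain ⟨h, hh, rfl⟩ := Finset.mem_image.1 ha
    obtain ⟨hhs, hhx⟩ := Finset.mem_filter.1 hh
    -- The finite description is valid only inside `Q`, so the step is shortened; convexity keeps
    -- the point in `P`.
    obtain ⟨r, hrQ, hr0, hrt⟩ :=
      ((hcont.eventually hQx).and (Ioo_mem_nhdsGT ht)).exists
    have hrP : x + r • u ∈ P := by
      have := hP.convex.add_smul_mem hx htP (t := r / t)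
        ⟨by positivity, (div_le_one ht).2 hrt.le⟩
      rwa [smul_smul, div_mul_cancel₀ _ ht.ne'] at this
    have := (hmem _).1 ⟨hrP, hrQ⟩ h hhs
    rw [inner_add_right, inner_smul_right, hhx] at this
    by_contra! hpos
    nlinarith [mul_pos hr0 hpos]
  · intro hA
    have hev : ∀ᶠ t in nhdsWithin (0 : ℝ) (Set.Ioi 0), ∀ h ∈ s, inner ℝ h.1 (x + t • u) ≤ h.2 := by
      rw [Filter.eventually_all_finset]
      intro h hhs
      rcases (hxs h hhs).eq_or_lt with heq | hlt
      · filter_upwards [self_mem_nhdsWithin] with t ht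
        have := hA h.1 (Finset.mem_image_of_mem _ (Finset.mem_filter.2 ⟨hhs, heq⟩))
        rw [inner_add_right, inner_smul_right, heq]
        nlinarith [mul_nonneg (le_of_lt (Set.mem_Ioi.1 ht)) (neg_nonneg.2 this)]
      · have hc : Continuous fun z : E => inner ℝ h.1 z := by fun_prop
        filter_upwards [hcont.eventually (hc.continuousAt.eventually (gt_mem_nhds hlt))] with t ht
        exact le_of_lt ht
    obtain ⟨t, ht, ht0⟩ := (hev.and self_mem_nhdsWithin).exists
    exact ⟨t, ht0, ((hmem _).2 ht).1⟩

/-- `D` is the direction space of the smallest face of `P` that contains `x`. -/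
def IsMinimalFaceDirection (P : Set E) (x : E) (D : Submodule ℝ E) : Prop :=
  ∀ u, u ∈ D ↔ IsFeasibleDirection P x u ∧ IsFeasibleDirection P x (-u)

/-- The sum of the active normals exposes the face: nonpositive terms sum to zero only if each one
vanishes. -/
theorem IsLocallyFinitePolyhedron.exists_isMinimalFaceDirection [FiniteDimensional ℝ E]
    {P : Set E} (hP : IsLocallyFinitePolyhedron P) {x : E} (hx : x ∈ P) :
    ∃ D : Submodule ℝ E, IsMinimalFaceDirection P x D ∧ IsFace P {z | z ∈ P ∧ z - x ∈ D} := by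
  obtain ⟨A, hA⟩ := hP.exists_active hx
  let D : Submodule ℝ E := ⨅ a ∈ A, (innerₗ E a).ker
  have hD : ∀ u, u ∈ D ↔ ∀ a ∈ A, inner ℝ a u = 0 := by
    intro u
    simp [D, Submodule.mem_iInf]
  have hneg : ∀ z ∈ P, ∀ a ∈ A, inner ℝ a (z - x) ≤ 0 := fun z hz =>
    (hA _).1 ⟨1, one_pos, by simpa using hz⟩
  refine ⟨D, fun u => ?_, ∑ a ∈ A, a, inner ℝ (∑ a ∈ A, a) x, fun z hz => ?_, ?_⟩
  · rw [hD, hA, hA]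
    simp only [inner_neg_right, Left.neg_nonpos_iff]
    exact ⟨fun h => ⟨fun a ha => (h a ha).le, fun a ha => (h a ha).ge⟩,
      fun h a ha => le_antisymm (h.1 a ha) (h.2 a ha)⟩
  · have := Finset.sum_nonpos (hneg z hz)
    rw [← sum_inner, inner_sub_right] at this
    exact sub_nonpos.1 this
  · ext z
    refine and_congr_right fun hz => ?_
    change _ ↔ inner ℝ (∑ a ∈ A, a) z = inner ℝ (∑ a ∈ A, a) x
    rw [hD, ← Finset.sum_eq_zero_iff_of_nonpos (hneg z hz), ← sum_inner, inner_sub_right,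
      sub_eq_zero]

/-- Feasibility of a direction at an end of a segment in a convex set implies feasibility at the
inner points of the segment. -/
theorem IsFeasibleDirection.of_mem_openSegment {P : Set E} (hP : Convex ℝ P) {x y z u : E}
    (hz : z ∈ P) (hx : x ∈ openSegment ℝ y z) (h : IsFeasibleDirection P y u) :
    IsFeasibleDirection P x u := by
  obtain ⟨t, ht, htP⟩ := h
  obtain ⟨p, q, hp, hq, hpq, rfl⟩ := hx
  refine ⟨p * t, mul_pos hp ht, ?_⟩
  have := hP htP hz hp.le hq.le hpq
  rwa [smul_add, smul_smul, add_right_comm] at this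

/-- If `P` does not contain the ray from `x` in the direction `d`, then the ray leaves `P` at a
last point, from where `d` is not feasible. -/
theorem exists_last_point {P : Set E} (hP : Convex ℝ P) (hc : IsClosed P) {x d : E} (hx : x ∈ P)
    (hd : ¬ ∀ t : ℝ, 0 ≤ t → x + t • d ∈ P) :
    ∃ t : ℝ, 0 ≤ t ∧ x + t • d ∈ P ∧ ¬ IsFeasibleDirection P (x + t • d) d := by
  push Not at hd
  obtain ⟨r, hr0, hr⟩ := hd
  let S : Set ℝ := {t | 0 ≤ t ∧ x + t • d ∈ P}
  have hbd : ∀ t ∈ S, t ≤ r := by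
    rintro t ⟨ht0, ht⟩
    by_contra! hlt
    apply hr
    have htpos : 0 < t := hr0.trans_lt hlt
    have := hP.add_smul_mem hx ht (t := r / t) ⟨by positivity, (div_le_one htpos).2 hlt.le⟩
    rwa [smul_smul, div_mul_cancel₀ _ htpos.ne'] at this
  have hSc : IsClosed S := isClosed_Ici.inter (hc.preimage (by fun_prop))
  have hSn : S.Nonempty := ⟨0, le_rfl, by simpa using hx⟩
  have hmem : sSup S ∈ S := hSc.csSup_mem hSn ⟨r, hbd⟩
  refine ⟨sSup S, hmem.1, hmem.2, ?_⟩
  rintro ⟨t, ht, htP⟩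
  have : sSup S + t ∈ S := ⟨by linarith [hmem.1], by rwa [add_smul, ← add_assoc]⟩
  linarith [le_csSup ⟨r, hbd⟩ this]

theorem isVertex_of_isMinimalFaceDirection_bot [FiniteDimensional ℝ E] {P : Set E}
    (hP : IsLocallyFinitePolyhedron P) {x : E} (hx : x ∈ P)
    (hD : IsMinimalFaceDirection P x ⊥) : IsVertex P x := by
  obtain ⟨D, hD', hF⟩ := hP.exists_isMinimalFaceDirection hx
  obtain rfl : D = ⊥ := by ext u; rw [hD', hD]
  suffices h : ({x} : Set E) = {z | z ∈ P ∧ z - x ∈ (⊥ : Submodule ℝ E)} by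
    rwa [IsVertex, h]
  ext z
  simp only [Set.mem_singleton_iff, Submodule.mem_bot, sub_eq_zero, Set.mem_ofPred_eq]
  exact ⟨fun h => ⟨h ▸ hx, h⟩, And.right⟩

/-! ### Extreme rays -/

theorem vectorSpan_ray (y d : E) :
    vectorSpan ℝ {x | ∃ t : ℝ, 0 ≤ t ∧ x = y + t • d} = Submodule.span ℝ {d} := by
  apply le_antisymm
  · rw [vectorSpan_def, Submodule.span_le]
    rintro _ ⟨_, ⟨s, -, rfl⟩, _, ⟨t, -, rfl⟩, rfl⟩
    refine Submodule.mem_span_singleton.2 ⟨s - t, ?_⟩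
    simp only [vsub_eq_sub]
    module
  · rw [Submodule.span_singleton_le_iff_mem]
    have := vsub_mem_vectorSpan ℝ (s := {x | ∃ t : ℝ, 0 ≤ t ∧ x = y + t • d})
      (p₁ := y + (1 : ℝ) • d) (p₂ := y + (0 : ℝ) • d) ⟨1, zero_le_one, rfl⟩ ⟨0, le_rfl, rfl⟩
    simpa using this

theorem not_isBounded_ray (y : E) {d : E} (hd : d ≠ 0) :
    ¬ Bornology.IsBounded {x | ∃ t : ℝ, 0 ≤ t ∧ x = y + t • d} := by
  intro h
  obtain ⟨C, hC⟩ := h.subset_closedBall y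
  have hdn := norm_pos_iff.2 hd
  have := hC ⟨(|C| + 1) / ‖d‖, by positivity, rfl⟩
  rw [mem_closedBall_iff_norm, add_sub_cancel_left, norm_smul, Real.norm_of_nonneg (by positivity),
    div_mul_cancel₀ _ hdn.ne'] at this
  linarith [le_abs_self C]

/-- If the smallest face around `x` is one-dimensional and contains a ray in the direction `d`,
then `x` lies on an extreme ray in that direction. -/
theorem exists_isVertex_add_smul [FiniteDimensional ℝ E] {P : Set E}
    (hP : IsLocallyFinitePolyhedron P) {x d : E} (hx : x ∈ P) (hd : d ≠ 0)
    (hD : IsMinimalFaceDirection P x (Submodule.span ℝ {d}))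
    (hray : ∀ t : ℝ, 0 ≤ t → x + t • d ∈ P) (hneg : ¬ ∀ t : ℝ, 0 ≤ t → x + t • (-d) ∈ P) :
    ∃ y, IsVertex P y ∧ IsExtremeRayDirection P d ∧ ∃ t : ℝ, 0 ≤ t ∧ x = y + t • d := by
  obtain ⟨t, ht, hyP, hy⟩ := exists_last_point hP.convex hP.isClosed hx hneg
  set y := x + t • (-d) with hydef
  have hxy : x = y + t • d := by rw [hydef]; module
  have hseg : x ∈ openSegment ℝ y (x + d) := by
    refine ⟨1 / (1 + t), t / (1 + t), by positivity, ?_, by field_simp, ?_⟩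
    -- For `t = 0` the second weight would vanish, but `-d ∈ D` is feasible at `x`, so `x` is not
    -- the last point.
    · rcases ht.eq_or_lt with rfl | h
      · have := (hD (-d)).1 (Submodule.neg_mem _ (Submodule.mem_span_singleton_self d))
        simp only [hydef, zero_smul, add_zero] at hy
        exact absurd this.1 hy
      · positivity
    · rw [hydef]
      match_scalars <;> field_simp
      ring
  have hxd : x + d ∈ P := by simpa using hray 1 zero_le_one
  have hrayy : ∀ s : ℝ, 0 ≤ s → y + s • d ∈ P := by
    intro s hs
    refine hP.add_mem_of_ray (x := x) (d := s • d) (fun r hr => ?_) hyP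
    rw [smul_smul]
    exact hray _ (mul_nonneg hr hs)
  have hvert : IsVertex P y := by
    refine isVertex_of_isMinimalFaceDirection_bot hP hyP fun u => ?_
    rw [Submodule.mem_bot]
    constructor
    · rintro rfl
      exact ⟨⟨1, one_pos, by simpa using hyP⟩, ⟨1, one_pos, by simpa using hyP⟩⟩
    · rintro ⟨h1, h2⟩
      -- A direction feasible both ways at `y` is so at `x`, hence is `c • d`; for `c ≠ 0` it or its
      -- negative points along `-d`, which is infeasible at `y`.
      obtain ⟨c, rfl⟩ := Submodule.mem_span_singleton.1 ((hD u).2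
        ⟨h1.of_mem_openSegment hP.convex hxd hseg, h2.of_mem_openSegment hP.convex hxd hseg⟩)
      rcases lt_trichotomy c 0 with hc | rfl | hc
      · obtain ⟨s, hs, hsP⟩ := h1
        refine absurd ⟨s * -c, mul_pos hs (neg_pos.2 hc), ?_⟩ hy
        convert hsP using 2
        module
      · simp
      · obtain ⟨s, hs, hsP⟩ := h2
        refine absurd ⟨s * c, mul_pos hs hc, ?_⟩ hy
        convert hsP using 2
        module
  refine ⟨y, hvert, ⟨y, ⟨?_, ?_⟩, not_isBounded_ray y hd, y, ⟨0, le_rfl, by simp⟩, hvert⟩, t, ht,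
    hxy⟩
  · obtain ⟨D, hD', hF⟩ := hP.exists_isMinimalFaceDirection hx
    obtain rfl : D = Submodule.span ℝ {d} := by ext u; rw [hD', hD]
    convert hF using 1
    ext z
    constructor
    · rintro ⟨s, hs, rfl⟩
      refine ⟨hrayy s hs, Submodule.mem_span_singleton.2 ⟨s - t, ?_⟩⟩
      rw [hydef]
      module
    · rintro ⟨hz, hzD⟩
      obtain ⟨c, hc⟩ := Submodule.mem_span_singleton.1 hzD
      have hzy : z = y + (t + c) • d := by
        rw [← sub_add_cancel z x, ← hc, hydef]
        module
      refine ⟨t + c, ?_, hzy⟩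
      by_contra! hlt
      refine hy ⟨-(t + c), by linarith, ?_⟩
      rw [smul_neg, neg_smul, neg_neg, ← hzy]
      exact hz
  · rw [vectorSpan_ray, finrank_span_singleton hd]

/-- The functional that exposes a vertex of `P` is negative on the directions of rays in `P`. -/
theorem inner_neg_of_ray {P : Set E} (hP : IsLocallyFinitePolyhedron P) {V a : E} {β : ℝ}
    (hsub : P ⊆ halfspace a β) (hV : {V} = P ∩ hyperplane a β) {x d : E} (hd : d ≠ 0)
    (hray : ∀ t : ℝ, 0 ≤ t → x + t • d ∈ P) : inner ℝ a d < 0 := by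
  have hVm : V ∈ P ∩ hyperplane a β := hV ▸ Set.mem_singleton V
  have hVd := hP.add_mem_of_ray hray hVm.1
  have hVa : inner ℝ a V = β := hVm.2
  have hle : inner ℝ a (V + d) ≤ β := hsub hVd
  refine lt_of_le_of_ne (by rw [inner_add_right] at hle; linarith) fun h0 => hd ?_
  have : V + d ∈ ({V} : Set E) := by
    rw [hV]
    refine ⟨hVd, ?_⟩
    change inner ℝ a (V + d) = β
    rw [inner_add_right, h0, hVa, add_zero]
  simpa using this

/-! ### Induction on the dimension of the minimal face -/

/-- A convex set that contains every vertex of `P` and every translate of a vertex along the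
direction of an extreme ray contains `P`. -/
theorem IsLocallyFinitePolyhedron.subset_of_convex [FiniteDimensional ℝ E] {P : Set E}
    (hP : IsLocallyFinitePolyhedron P) (hV : ∃ V, IsVertex P V) {K : Set E} (hK : Convex ℝ K)
    (hKv : ∀ y, IsVertex P y → y ∈ K)
    (hKr : ∀ y, IsVertex P y → ∀ d, IsExtremeRayDirection P d → ∀ t : ℝ, 0 ≤ t → y + t • d ∈ K) :
    P ⊆ K := by
  obtain ⟨V, a, β, hsub, hVa⟩ := hV
  suffices H : ∀ n : ℕ, ∀ x ∈ P, ∀ D : Submodule ℝ E, IsMinimalFaceDirection P x D →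
      Module.finrank ℝ D = n → x ∈ K by
    intro x hx
    obtain ⟨D, hD, -⟩ := hP.exists_isMinimalFaceDirection hx
    exact H _ x hx D hD rfl
  intro n
  induction n using Nat.strong_induction_on with
  | _ n ih =>
  intro x hx D hD hn
  by_cases hbot : D = ⊥
  · subst hbot
    exact hKv x (isVertex_of_isMinimalFaceDirection_bot hP hx hD)
  by_cases hsplit : ∃ d ∈ D, d ≠ 0 ∧ (¬ ∀ t : ℝ, 0 ≤ t → x + t • d ∈ P) ∧
      ¬ ∀ t : ℝ, 0 ≤ t → x + t • (-d) ∈ P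
  · obtain ⟨d, hdD, hd0, hd1, hd2⟩ := hsplit
    obtain ⟨s, hs, hyP, hy⟩ := exists_last_point hP.convex hP.isClosed hx hd1
    obtain ⟨t, ht, hzP, hz⟩ := exists_last_point hP.convex hP.isClosed hx hd2
    obtain ⟨hf1, hf2⟩ := (hD d).1 hdD
    have hs' : 0 < s := by
      refine hs.lt_of_ne ?_
      rintro rfl
      simp [hf1] at hy
    have ht' : 0 < t := by
      refine ht.lt_of_ne ?_
      rintro rfl
      simp [hf2] at hz
    have hseg : x ∈ openSegment ℝ (x + s • d) (x + t • (-d)) := by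
      refine ⟨t / (s + t), s / (s + t), by positivity, by positivity, by field_simp; ring, ?_⟩
      match_scalars <;> field_simp <;> ring
    -- Passing to an endpoint can only shrink `D`, and it loses `e`, so the induction hypothesis
    -- applies.
    have key : ∀ y z e : E, y ∈ P → z ∈ P → x ∈ openSegment ℝ y z → e ∈ D →
        ¬ IsFeasibleDirection P y e → y ∈ K := by
      intro y z e hy hz hseg he hye
      obtain ⟨D', hD', -⟩ := hP.exists_isMinimalFaceDirection hy
      have hlt : D' < D := by
        refine lt_of_le_of_ne (fun u hu => ?_) ?_
        · obtain ⟨h1, h2⟩ := (hD' u).1 hu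
          exact (hD u).2 ⟨h1.of_mem_openSegment hP.convex hz hseg,
            h2.of_mem_openSegment hP.convex hz hseg⟩
        · rintro rfl
          exact hye ((hD' e).1 he).1
      exact ih _ (hn ▸ Submodule.finrank_lt_finrank_of_lt hlt) y hy D' hD' rfl
    exact hK.openSegment_subset (key _ _ d hyP hzP hseg hdD hy)
      (key _ _ (-d) hzP hyP (openSegment_symm ℝ (x + s • d) (x + t • (-d)) ▸ hseg) (D.neg_mem hdD) hz) hseg
  push Not at hsplit
  -- Now `d` or `-d` spans a ray in `P`, on whose direction the exposing functional is nonzero.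
  have hker : ∀ d ∈ D, inner ℝ a d = 0 → d = 0 := by
    intro d hdD hd
    by_contra hd0
    by_cases h : ∀ t : ℝ, 0 ≤ t → x + t • d ∈ P
    · exact (inner_neg_of_ray hP hsub hVa hd0 h).ne hd
    · push Not at h
      have := inner_neg_of_ray hP hsub hVa (neg_ne_zero.2 hd0) (hsplit d hdD hd0 h)
      rw [inner_neg_right, hd] at this
      simp at this
  obtain ⟨d, hdD, hd0, hray⟩ : ∃ d ∈ D, d ≠ 0 ∧ ∀ t : ℝ, 0 ≤ t → x + t • d ∈ P := by
    obtain ⟨d, hdD, hd0⟩ := Submodule.exists_mem_ne_zero_of_ne_bot hbot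
    by_cases h : ∀ t : ℝ, 0 ≤ t → x + t • d ∈ P
    · exact ⟨d, hdD, hd0, h⟩
    · push Not at h
      exact ⟨-d, D.neg_mem hdD, neg_ne_zero.2 hd0, hsplit d hdD hd0 h⟩
  have had := inner_neg_of_ray hP hsub hVa hd0 hray
  have hspan : D = Submodule.span ℝ {d} := by
    refine le_antisymm (fun u hu => ?_) (by simpa using hdD)
    refine Submodule.mem_span_singleton.2 ⟨inner ℝ a u / inner ℝ a d, ?_⟩
    rw [eq_comm, ← sub_eq_zero]
    refine hker _ (D.sub_mem hu (D.smul_mem _ hdD)) ?_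
    rw [inner_sub_right, inner_smul_right, div_mul_cancel₀ _ had.ne, sub_self]
  have hneg : ¬ ∀ t : ℝ, 0 ≤ t → x + t • (-d) ∈ P := by
    intro h
    have := inner_neg_of_ray hP hsub hVa (neg_ne_zero.2 hd0) h
    rw [inner_neg_right] at this
    linarith
  obtain ⟨y, hy, hdir, t, ht, rfl⟩ := exists_isVertex_add_smul hP hx hd0 (hspan ▸ hD) hray hneg
  exact hKr y hy d hdir t ht

theorem IsVertex.mem {P : Set E} {V : E} (h : IsVertex P V) : V ∈ P := by
  obtain ⟨a, β, -, hV⟩ := h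
  have : V ∈ P ∩ hyperplane a β := hV ▸ Set.mem_singleton V
  exact this.1

theorem IsExtremeRayDirection.exists_ray {P : Set E} {R : E} (h : IsExtremeRayDirection P R) :
    ∃ V, ∀ t : ℝ, 0 ≤ t → V + t • R ∈ P := by
  obtain ⟨V, ⟨⟨a, β, -, hF⟩, -⟩, -⟩ := h
  refine ⟨V, fun t ht => ?_⟩
  have : V + t • R ∈ P ∩ hyperplane a β := by
    rw [← hF]
    exact ⟨t, ht, rfl⟩
  exact this.1

/-- A locally finite polyhedron is closed under translation by the cone of its extreme rays. -/
theorem IsLocallyFinitePolyhedron.add_mem_of_mem_hull {P : Set E}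
    (hP : IsLocallyFinitePolyhedron P) {r : E}
    (hr : r ∈ PointedCone.hull ℝ {R | IsExtremeRayDirection P R}) :
    ∀ y ∈ P, y + r ∈ P := by
  induction hr using Submodule.span_induction with
  | mem R hR =>
    obtain ⟨V, hV⟩ := IsExtremeRayDirection.exists_ray hR
    exact fun y hy => hP.add_mem_of_ray hV hy
  | zero => simp
  | add r s _ _ hr hs =>
    intro y hy
    rw [← add_assoc]
    exact hs _ (hr y hy)
  | smul c r _ hr =>
    intro y hy
    -- Iterating translation by `r` gives natural multiples; convexity fills in the real ones.
    have hn : ∀ n : ℕ, y + (n : ℝ) • r ∈ P := by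
      intro n
      induction n with
      | zero => simpa using hy
      | succ n ih => simpa [add_smul, add_assoc] using hr _ ih
    obtain ⟨n, hcn⟩ := exists_nat_gt (c : ℝ)
    have hn0 : (0 : ℝ) < n := lt_of_le_of_lt c.2 hcn
    have := hP.convex.add_smul_mem hy (hn n) (t := (c : ℝ) / n)
      ⟨div_nonneg c.2 hn0.le, (div_le_one hn0).2 hcn.le⟩
    rwa [smul_smul, div_mul_cancel₀ _ hn0.ne'] at this

end Polyhedral

theorem mainTheorem10 {E : Type*} [NormedAddCommGroup E] [InnerProductSpace ℝ E]
    [FiniteDimensional ℝ E] (P : Set E) (hP : Polyhedral.IsLocallyFinitePolyhedron P)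
    (hV : ∃ V, Polyhedral.IsVertex P V) :
    P = convexHull ℝ {V | Polyhedral.IsVertex P V} +
      (PointedCone.hull ℝ {R | Polyhedral.IsExtremeRayDirection P R} : Set E) := by
  apply Set.Subset.antisymm
  · refine hP.subset_of_convex hV
      ((convex_convexHull ℝ _).add (PointedCone.convex _)) (fun y hy => ?_) fun y hy d hd t ht => ?_
    · exact ⟨y, subset_convexHull ℝ _ hy, 0, zero_mem _, add_zero y⟩
    · exact ⟨y, subset_convexHull ℝ _ hy, t • d,
        Submodule.smul_mem _ (⟨t, ht⟩ : {c : ℝ // 0 ≤ c}) (Submodule.subset_span hd), rfl⟩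
  · rintro _ ⟨y, hy, r, hr, rfl⟩
    exact hP.add_mem_of_mem_hull hr y (convexHull_min (fun V hV => Polyhedral.IsVertex.mem hV) hP.convex hy)
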